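/- Let $L$ be a field of characteristic zero, let $n \geq 1$, and let $f \in L[\mathbf x] = L[x_0,\dots,x_n]$ be homogeneous of degree $d$. Let $\operatorname{Jac} f$ be the ideal generated by $\partial_0 f,\dots,\partial_n f$, and assume (Hypothesis H) that the Jacobian ring $A = L[\mathbf x]/\operatorname{Jac} f$ is finite-dimensional over $L$. Let $L[\mathbf x,\tfrac1f]$ be the ring of rational functions whose denominator is a power of $f$, and for $p \in \mathbb Z$ let $L[\mathbf x,\tfrac1f]_p$ be its subspace of homogeneous functions of degree $p$, that is, of the fractions $a/f^l$ with $l \geq 0$ and $a$ a homogeneous polynomial of degree $p + ld$ (or $a = 0$). Let $D_f$ be the space of all sums $\sum_{i=0}^n \partial_i A_i$ with $A_0,\dots,A_n \in L[\mathbf x,\tfrac1f]_{-n}$; it is a subspace of $L[\mathbf x,\tfrac1f]_{-n-1}$. Put $H_f^{pr} = L[\mathbf x,\tfrac1f]_{-n-1}/D_f$. For every integer $l > 0$ let $A_l \subseteq A$ be the subspace spanned by the classes of the homogeneous polynomials of degree $ld-(n+1)$ (so $A_l = 0$ if $ld < n+1$), let $n_l = \dim_L A_l$, and let $g_{l,1},\dots,g_{l,n_l}$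 be homogeneous polynomials of degree $ld-(n+1)$ whose classes form a basis of $A_l$. Then the classes of the fractions $g_{l,i}/f^l$, for $l > 0$ and $1 \leq i \leq n_l$, form a basis of the $L$-vector space $H_f^{pr}$. -/

import Mathlib

open MvPolynomial

noncomputable section

namespace GriffithsDwork

section Polynomials

variable {σ L : Type*} [Field L]

/-- The space of homogeneous polynomials of degree `k`, where the degree `k` is an integer:
the polynomials all of whose monomials have total degree `k`.  It is zero for `k < 0`. -/
def homogPoly (σ L : Type*) [Field L] (k : ℤ) : Submodule L (MvPolynomial σ L) where
  carrier := {p | ∀ s : σ →₀ ℕ, coeff s p ≠ 0 → (s.degree : ℤ) = k}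
  zero_mem' := by
    intro s hs
    simp at hs
  add_mem' := by
    intro p q hp hq s hs
    by_cases h : coeff s p = 0
    · apply hq s
      intro h'
      exact hs (by rw [coeff_add, h, h', add_zero])
    · exact hp s h
  smul_mem' := by
    intro c p hp s hs
    apply hp s
    intro h
    exact hs (by rw [coeff_smul, h, smul_zero])

theorem mem_homogPoly_natCast {p : MvPolynomial σ L} {m : ℕ} :
    p ∈ homogPoly σ L (m : ℤ) ↔ p.IsHomogeneous m := by
  constructor
  · intro h s hs
    have h1 := h s hs
    rw [Finsupp.degree_eq_weight_one] at h1
    exact_mod_cast h1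
  · intro h s hs
    have h1 := h hs
    have h2 : s.degree = m := by
      rw [Finsupp.degree_eq_weight_one]
      exact h1
    exact_mod_cast h2

theorem mem_homogPoly_iff {p : MvPolynomial σ L} {k : ℤ} :
    p ∈ homogPoly σ L k ↔ p = 0 ∨ ∃ m : ℕ, (m : ℤ) = k ∧ p.IsHomogeneous m := by
  constructor
  · intro h
    by_cases hp : p = 0
    · exact Or.inl hp
    · obtain ⟨s, hs⟩ := MvPolynomial.ne_zero_iff.1 hp
      refine Or.inr ⟨s.degree, h s hs, ?_⟩
      rw [← mem_homogPoly_natCast, h s hs]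
      exact h
  · rintro (rfl | ⟨m, rfl, h⟩)
    · exact Submodule.zero_mem _
    · exact mem_homogPoly_natCast.2 h

theorem mul_mem_homogPoly {p q : MvPolynomial σ L} {k j : ℤ}
    (hp : p ∈ homogPoly σ L k) (hq : q ∈ homogPoly σ L j) : p * q ∈ homogPoly σ L (k + j) := by
  rw [mem_homogPoly_iff] at hp hq ⊢
  rcases hp with rfl | ⟨a, rfl, hp⟩
  · left
    simp
  rcases hq with rfl | ⟨b, rfl, hq⟩
  · left
    simp
  · exact Or.inr ⟨a + b, by push_cast; rfl, hp.mul hq⟩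

theorem pderiv_mem_homogPoly {p : MvPolynomial σ L} {k : ℤ} (i : σ)
    (hp : p ∈ homogPoly σ L k) : pderiv i p ∈ homogPoly σ L (k - 1) := by
  intro s hs
  rw [coeff_pderiv] at hs
  have h1 := hp _ (left_ne_zero_of_mul hs)
  rw [map_add, Finsupp.degree_single] at h1
  push_cast at h1
  linarith

/-- The Jacobian ideal of `f`, generated by the partial derivatives of `f`. -/
def jacobianIdeal (f : MvPolynomial σ L) : Ideal (MvPolynomial σ L) :=
  Ideal.span (Set.range fun i : σ => pderiv i f)

/-- The Jacobian ring `L[x] / Jac f`. -/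
abbrev JacobianRing (f : MvPolynomial σ L) : Type _ :=
  MvPolynomial σ L ⧸ jacobianIdeal f

/-- The subspace of the Jacobian ring spanned by the classes of the homogeneous polynomials of
(integer) degree `k`. -/
def jacobianPart (f : MvPolynomial σ L) (k : ℤ) : Submodule L (JacobianRing f) :=
  (homogPoly σ L k).map (Ideal.Quotient.mkₐ L (jacobianIdeal f)).toLinearMap

end Polynomials

section Fractions

variable {σ L : Type*} [Field L]

/-- The ring `L[x, 1/f]` of the fractions whose denominator is a power of `f`. -/
abbrev FracRing (f : MvPolynomial σ L) : Type _ := Localization.Away f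

/-- The fraction `a / f ^ l` in `L[x, 1/f]`. -/
def frac (f a : MvPolynomial σ L) (l : ℕ) : FracRing f :=
  IsLocalization.mk' (FracRing f) a (⟨f ^ l, l, rfl⟩ : Submonoid.powers f)

theorem frac_eq_iff (f a : MvPolynomial σ L) (l : ℕ) (F : FracRing f) :
    frac f a l = F ↔ algebraMap _ (FracRing f) a = F * algebraMap _ (FracRing f) f ^ l := by
  rw [frac, IsLocalization.mk'_eq_iff_eq_mul, map_pow]

theorem frac_mul_pow (f a : MvPolynomial σ L) (l : ℕ) :
    frac f a l * algebraMap _ (FracRing f) f ^ l = algebraMap _ (FracRing f) a :=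
  ((frac_eq_iff f a l _).1 rfl).symm

theorem isUnit_algebraMap (f : MvPolynomial σ L) : IsUnit (algebraMap _ (FracRing f) f) :=
  IsLocalization.Away.algebraMap_isUnit f

theorem exists_frac (f : MvPolynomial σ L) (F : FracRing f) :
    ∃ (a : MvPolynomial σ L) (l : ℕ), F = frac f a l := by
  obtain ⟨a, ⟨_, l, rfl⟩, h⟩ := IsLocalization.exists_mk'_eq (Submonoid.powers f) F
  exact ⟨a, l, h.symm⟩

theorem frac_add (f a b : MvPolynomial σ L) (l m : ℕ) :
    frac f a l + frac f b m = frac f (a * f ^ m + b * f ^ l) (l + m) := by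
  symm
  rw [frac_eq_iff, map_add, map_mul, map_mul, ← frac_mul_pow f a l, ← frac_mul_pow f b m,
    map_pow, map_pow]
  ring

theorem smul_frac (f a : MvPolynomial σ L) (l : ℕ) (c : L) :
    c • frac f a l = frac f (c • a) l := by
  symm
  rw [frac_eq_iff, smul_mul_assoc, frac_mul_pow, Algebra.smul_def, Algebra.smul_def, map_mul,
    ← IsScalarTower.algebraMap_apply]

theorem frac_zero (f : MvPolynomial σ L) (l : ℕ) : frac f 0 l = 0 := by
  rw [frac_eq_iff, map_zero, zero_mul]

/-- The ring morphism `a ↦ a + ε ∂ᵢ a` from `L[x]` to the dual numbers over `L[x, 1/f]`. -/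
def dualHom (f : MvPolynomial σ L) (i : σ) :
    MvPolynomial σ L →+* TrivSqZeroExt (FracRing f) (FracRing f) where
  toFun a := TrivSqZeroExt.inl (algebraMap _ (FracRing f) a) +
    TrivSqZeroExt.inr (algebraMap _ (FracRing f) (pderiv i a))
  map_one' := by
    rw [Derivation.map_one_eq_zero, map_one, map_zero, TrivSqZeroExt.inl_one,
      TrivSqZeroExt.inr_zero, add_zero]
  map_zero' := by
    rw [map_zero, map_zero, map_zero, TrivSqZeroExt.inl_zero, TrivSqZeroExt.inr_zero, add_zero]
  map_add' a b := by
    rw [map_add, map_add, map_add, TrivSqZeroExt.inl_add, TrivSqZeroExt.inr_add]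
    abel
  map_mul' a b := by
    ext
    · simp only [TrivSqZeroExt.fst_add, TrivSqZeroExt.fst_mul, TrivSqZeroExt.fst_inl,
        TrivSqZeroExt.fst_inr, map_mul, add_zero]
    · simp only [TrivSqZeroExt.snd_add, TrivSqZeroExt.snd_mul, TrivSqZeroExt.fst_add,
        TrivSqZeroExt.fst_inl, TrivSqZeroExt.fst_inr, TrivSqZeroExt.snd_inl,
        TrivSqZeroExt.snd_inr, Derivation.leibniz, map_mul, map_add, add_zero, zero_add,
        smul_eq_mul, op_smul_eq_mul]
      ring

theorem dualHom_fst (f : MvPolynomial σ L) (i : σ) (a : MvPolynomial σ L) :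
    (dualHom f i a).fst = algebraMap _ (FracRing f) a := by
  rw [dualHom, RingHom.coe_mk, MonoidHom.coe_mk, OneHom.coe_mk, TrivSqZeroExt.fst_add,
    TrivSqZeroExt.fst_inl, TrivSqZeroExt.fst_inr, add_zero]

theorem dualHom_snd (f : MvPolynomial σ L) (i : σ) (a : MvPolynomial σ L) :
    (dualHom f i a).snd = algebraMap _ (FracRing f) (pderiv i a) := by
  rw [dualHom, RingHom.coe_mk, MonoidHom.coe_mk, OneHom.coe_mk, TrivSqZeroExt.snd_add,
    TrivSqZeroExt.snd_inl, TrivSqZeroExt.snd_inr, zero_add]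

theorem isUnit_dualHom (f : MvPolynomial σ L) (i : σ) : IsUnit (dualHom f i f) := by
  rw [TrivSqZeroExt.isUnit_iff_isUnit_fst, dualHom_fst]
  exact isUnit_algebraMap f

/-- The extension of `dualHom` to `L[x, 1/f]`; its second component is `∂ᵢ`. -/
def dualLift (f : MvPolynomial σ L) (i : σ) :
    FracRing f →+* TrivSqZeroExt (FracRing f) (FracRing f) :=
  IsLocalization.Away.lift f (isUnit_dualHom f i)

theorem dualLift_algebraMap (f : MvPolynomial σ L) (i : σ) (a : MvPolynomial σ L) :
    dualLift f i (algebraMap _ _ a) = dualHom f i a :=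
  IsLocalization.Away.lift_eq f (isUnit_dualHom f i) a

theorem dualLift_fst (f : MvPolynomial σ L) (i : σ) (F : FracRing f) :
    (dualLift f i F).fst = F := by
  have h : ((TrivSqZeroExt.fstHom (FracRing f) (FracRing f) (FracRing f)).toRingHom.comp
      (dualLift f i)) = RingHom.id (FracRing f) := by
    apply IsLocalization.ringHom_ext (Submonoid.powers f)
    ext a
    · change (dualLift f i (algebraMap _ _ (C a))).fst = _
      rw [dualLift_algebraMap, dualHom_fst]
      rfl
    · change (dualLift f i (algebraMap _ _ (X a))).fst = _
      rw [dualLift_algebraMap, dualHom_fst]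
      rfl
  exact congrArg (fun φ : FracRing f →+* FracRing f => φ F) h

/-- The partial derivative `∂ᵢ` on `L[x, 1/f]`: the unique derivation which extends `∂ᵢ` on
`L[x]`.  It obeys the quotient rule `partialD_frac` below. -/
def partialD (f : MvPolynomial σ L) (i : σ) : Derivation L (FracRing f) (FracRing f) where
  toFun F := (dualLift f i F).snd
  map_add' F G := by rw [map_add, TrivSqZeroExt.snd_add]
  map_smul' c F := by
    rw [Algebra.smul_def, map_mul, TrivSqZeroExt.snd_mul, dualLift_fst, dualLift_fst,
      IsScalarTower.algebraMap_apply L (MvPolynomial σ L) (FracRing f), dualLift_algebraMap,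
      dualHom_snd, RingHom.id_apply, Algebra.smul_def c,
      IsScalarTower.algebraMap_apply L (MvPolynomial σ L) (FracRing f)]
    simp
  map_one_eq_zero' := by
    change (dualLift f i 1).snd = 0
    rw [map_one, TrivSqZeroExt.snd_one]
  leibniz' F G := by
    change (dualLift f i (F * G)).snd = F • (dualLift f i G).snd + G • (dualLift f i F).snd
    rw [map_mul, TrivSqZeroExt.snd_mul, dualLift_fst, dualLift_fst]
    simp [mul_comm]

theorem partialD_algebraMap (f : MvPolynomial σ L) (i : σ) (a : MvPolynomial σ L) :
    partialD f i (algebraMap _ _ a) = algebraMap _ _ (pderiv i a) := by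
  change (dualLift f i (algebraMap _ _ a)).snd = _
  rw [dualLift_algebraMap, dualHom_snd]

/-- The quotient rule `∂ᵢ (a / f ^ l) = (f ∂ᵢ a - l a ∂ᵢ f) / f ^ (l + 1)`. -/
theorem partialD_frac (f a : MvPolynomial σ L) (i : σ) (l : ℕ) :
    partialD f i (frac f a l) =
      frac f (f * pderiv i a - (l : L) • (a * pderiv i f)) (l + 1) := by
  symm
  rw [frac_eq_iff]
  have h := congrArg (partialD f i) (frac_mul_pow f a l)
  rw [partialD_algebraMap, Derivation.leibniz, Derivation.leibniz_pow, partialD_algebraMap] at h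
  rw [Nat.cast_smul_eq_nsmul L, nsmul_eq_mul, map_sub, map_mul, map_mul, map_mul, map_natCast,
    ← h, ← frac_mul_pow f a l]
  simp only [smul_eq_mul, nsmul_eq_mul]
  rcases l with _ | l
  · simp
    ring
  · simp only [Nat.add_sub_cancel]
    push_cast
    ring

/-- The space `L[x, 1/f]_p` of the fractions which are homogeneous of degree `p`, for `f`
homogeneous of degree `d`: the fractions `a / f ^ l` with `a` homogeneous of degree
`p + l d`. -/
def homogFrac {f : MvPolynomial σ L} {d : ℕ} (hf : f.IsHomogeneous d) (p : ℤ) :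
    Submodule L (FracRing f) where
  carrier := {F | ∃ (l : ℕ) (a : MvPolynomial σ L),
    a ∈ homogPoly σ L (p + l * d) ∧ F = frac f a l}
  zero_mem' := ⟨0, 0, Submodule.zero_mem _, (frac_zero f 0).symm⟩
  add_mem' := by
    rintro _ _ ⟨l, a, ha, rfl⟩ ⟨m, b, hb, rfl⟩
    have hpow : ∀ k : ℕ, f ^ k ∈ homogPoly σ L ((d * k : ℕ) : ℤ) := fun k =>
      mem_homogPoly_natCast.2 (hf.pow k)
    refine ⟨l + m, _, Submodule.add_mem _ ?_ ?_, frac_add f a b l m⟩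
    · convert mul_mem_homogPoly ha (hpow m) using 2
      push_cast
      ring
    · convert mul_mem_homogPoly hb (hpow l) using 2
      push_cast
      ring
  smul_mem' := by
    rintro c _ ⟨l, a, ha, rfl⟩
    exact ⟨l, c • a, Submodule.smul_mem _ c ha, smul_frac f a l c⟩

theorem frac_mem_homogFrac {f : MvPolynomial σ L} {d : ℕ} (hf : f.IsHomogeneous d) {p : ℤ}
    {a : MvPolynomial σ L} {l : ℕ} (ha : a ∈ homogPoly σ L (p + l * d)) :
    frac f a l ∈ homogFrac hf p :=
  ⟨l, a, ha, rfl⟩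

theorem partialD_mem_homogFrac {f : MvPolynomial σ L} {d : ℕ} (hf : f.IsHomogeneous d) {p : ℤ}
    {F : FracRing f} (i : σ) (hF : F ∈ homogFrac hf p) :
    partialD f i F ∈ homogFrac hf (p - 1) := by
  obtain ⟨l, a, ha, rfl⟩ := hF
  have hf' : f ∈ homogPoly σ L (d : ℤ) := mem_homogPoly_natCast.2 hf
  rw [partialD_frac]
  apply frac_mem_homogFrac
  refine Submodule.sub_mem _ ?_ (Submodule.smul_mem _ _ ?_)
  · convert mul_mem_homogPoly hf' (pderiv_mem_homogPoly i ha) using 2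
    push_cast
    ring
  · convert mul_mem_homogPoly ha (pderiv_mem_homogPoly i hf') using 2
    push_cast
    ring

end Fractions

section Cohomology

variable {L : Type*} [Field L] {n d : ℕ} {f : MvPolynomial (Fin (n + 1)) L}

/-- The space `D_f` of the fractions `∑ᵢ ∂ᵢ Aᵢ` with all `Aᵢ` in `L[x, 1/f]_{-n}`. -/
def exactPart (hf : f.IsHomogeneous d) : Submodule L (FracRing f) where
  carrier := {F | ∃ A : Fin (n + 1) → FracRing f,
    (∀ i, A i ∈ homogFrac hf (-(n : ℤ))) ∧ F = ∑ i, partialD f i (A i)}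
  zero_mem' := ⟨0, fun _ => Submodule.zero_mem _, by simp⟩
  add_mem' := by
    rintro _ _ ⟨A, hA, rfl⟩ ⟨B, hB, rfl⟩
    exact ⟨A + B, fun i => Submodule.add_mem _ (hA i) (hB i), by
      simp [Finset.sum_add_distrib]⟩
  smul_mem' := by
    rintro c _ ⟨A, hA, rfl⟩
    exact ⟨c • A, fun i => Submodule.smul_mem _ c (hA i), by simp [Finset.smul_sum]⟩

/-- `D_f` is contained in `L[x, 1/f]_{-n-1}`. -/
theorem exactPart_le (hf : f.IsHomogeneous d) :
    exactPart hf ≤ homogFrac hf (-(n : ℤ) - 1) := by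
  rintro _ ⟨A, hA, rfl⟩
  exact Submodule.sum_mem _ fun i _ => partialD_mem_homogFrac hf i (hA i)

/-- The quotient space `H_f^pr = L[x, 1/f]_{-n-1} / D_f`. -/
abbrev Hpr (hf : f.IsHomogeneous d) : Type _ :=
  homogFrac hf (-(n : ℤ) - 1) ⧸ (exactPart hf).submoduleOf (homogFrac hf (-(n : ℤ) - 1))

/-- The class in `H_f^pr` of an element of `L[x, 1/f]_{-n-1}`. -/
def Hpr.mk (hf : f.IsHomogeneous d) (F : FracRing f) (hF : F ∈ homogFrac hf (-(n : ℤ) - 1)) :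
    Hpr hf :=
  Submodule.Quotient.mk ⟨F, hF⟩

/-- The space `A_l`: the part of degree `l d - (n + 1)` of the Jacobian ring of `f`. -/
abbrev jacobianA (f : MvPolynomial (Fin (n + 1)) L) (d l : ℕ) : Submodule L (JacobianRing f) :=
  jacobianPart f ((l : ℤ) * d - (n + 1))

theorem frac_mem_of_mem {g : MvPolynomial (Fin (n + 1)) L} {l : ℕ} (hf : f.IsHomogeneous d)
    (hg : g ∈ homogPoly (Fin (n + 1)) L ((l : ℤ) * d - (n + 1))) :
    frac f g l ∈ homogFrac hf (-(n : ℤ) - 1) := by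
  apply frac_mem_homogFrac
  convert hg using 2
  ring

end Cohomology

end GriffithsDwork

end

/-! The mechanism is reduction of the pole order. Modulo exact fractions, `l * a * ∂ᵢ f / f ^ (l +
1)` equals `∂ᵢ a / f ^ l`, so a fraction with numerator in Jac f can be moved to a smaller pole
(`exists_frac_sub_mem_exactPart`). Subtracting from a numerator the combination of the `g l i` with
the same class in `A_l`, and descending on `l`, gives spanning (`homogFrac_le_span_sup_exactPart`).

Independence rests on a converse: if `g / f ^ k` is exact, then `g` lies in Jac f
(`mem_jacobianIdeal_of_frac_mem_exactPart`). Write the fraction as `∑ ∂ᵢ (aᵢ / f ^ m)`. If `m < k`,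
comparing numerators suffices, since `f` lies in Jac f by Euler's formula. Otherwise `f` divides `∑
aᵢ ∂ᵢ f`, and `exists_lower_pole` lowers `m`: after subtraction of a multiple of the Euler vector
field, `a` is a syzygy of the partial derivatives. Such syzygies are trivial
(`exists_homogPoly_antisymm`), and the second-order terms coming from an alternating matrix cancel
because mixed derivatives commute.

Syzygies are trivial because finite-dimensionality puts a power of every variable into Jac f. These
powers form a regular sequence of length `n + 1`, which forces the Koszul complex of the partial
derivatives to be exact in degree one (`koszul_exact_mod`). -/

noncomputable section

namespace GriffithsDwork

/-! ### Koszul exactness in the exterior algebra. -/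

section Koszul

variable {R : Type*} [CommRing R]

theorem mem_ideal_smul_top_iff_repr {ι E : Type*} [AddCommGroup E] [Module R E]
    (B : Module.Basis ι R E) (J : Ideal R) (k : E) :
    k ∈ J • (⊤ : Submodule R E) ↔ ∀ i, B.repr k i ∈ J := by
  constructor
  · intro h i
    induction h using Submodule.smul_induction_on' with
    | smul r hr x _ =>
      rw [map_smul, Finsupp.smul_apply, smul_eq_mul]
      exact J.mul_mem_right _ hr
    | add x _ y _ hx hy =>
      rw [map_add, Finsupp.add_apply]
      exact J.add_mem hx hy
  · intro h
    rw [← B.linearCombination_repr k, Finsupp.linearCombination_apply]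
    exact Submodule.sum_mem _ fun i _ => Submodule.smul_mem_smul (h i) trivial

theorem map_mem_ideal_smul_top {E : Type*} [AddCommGroup E] [Module R E]
    (φ : E →ₗ[R] E) {J : Ideal R} {k : E} (hk : k ∈ J • (⊤ : Submodule R E)) :
    φ k ∈ J • (⊤ : Submodule R E) := by
  have h := Submodule.mem_map_of_mem (f := φ) hk
  rw [Submodule.map_smul''] at h
  exact Submodule.smul_mono le_rfl le_top h

/-- The Koszul complex of `φ` is exact, in degrees larger than `r` and modulo `y 0, …, y (r - 1)`,
if the ideal generated by the values of `φ` contains a regular sequence whose length is the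
rank of the module. -/
theorem koszul_exact_mod [Nontrivial R] {N : ℕ} (φ : Module.Dual R (Fin N → R)) (y : ℕ → R)
    (hy : ∀ r < N, ∀ p, y r * p ∈ Ideal.span (y '' Set.Iio r) → p ∈ Ideal.span (y '' Set.Iio r))
    (hφ : ∀ r < N, ∃ a, φ a = y r) {r : ℕ} (hr : r ≤ N) :
    ∀ i, r < i → ∀ z ∈ ⋀[R]^i (Fin N → R),
      CliffordAlgebra.contractLeft φ z ∈
        Ideal.span (y '' Set.Iio r) • (⊤ : Submodule R (ExteriorAlgebra R (Fin N → R))) →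
      ∃ w : ExteriorAlgebra R (Fin N → R), z - CliffordAlgebra.contractLeft φ w ∈
        Ideal.span (y '' Set.Iio r) • (⊤ : Submodule R (ExteriorAlgebra R (Fin N → R))) := by
  induction hr using Nat.decreasingInduction with
  | self =>
    intro i hi z hz _
    -- The descent on `r` starts at `r = N`, where exterior powers of degree above the rank vanish.
    have h1 : Module.finrank R (⋀[R]^i (Fin N → R)) = 0 := by
      rw [exteriorPower.finrank_eq, Module.finrank_fin_fun, Nat.choose_eq_zero_of_lt hi]
    have h2 : Subsingleton (⋀[R]^i (Fin N → R)) := Module.finrank_eq_zero_iff_of_free _ _ |>.1 h1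
    have h3 : z = 0 := congrArg Subtype.val (Subsingleton.elim (⟨z, hz⟩ : ⋀[R]^i (Fin N → R)) 0)
    exact ⟨0, by simp [h3]⟩
  | of_succ r hr ih =>
    intro i hi z hz hdz
    obtain ⟨a, ha⟩ := hφ r hr
    set J := Ideal.span (y '' Set.Iio r) with hJ
    have hJ' : Ideal.span (y '' Set.Iio (r + 1)) = Ideal.span {y r} ⊔ J := by
      rw [hJ, ← Ideal.span_union, ← Set.image_singleton, ← Set.image_union]
      congr 2
      ext j
      simp only [Set.mem_Iio, Set.mem_union, Set.mem_singleton_iff]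
      omega
    rw [hJ'] at ih
    -- Multiplication by `a` is a homotopy for `y r`: the product `a * z` is a cycle modulo `y r`
    -- and `J`, one degree higher, so the induction hypothesis applies to it.
    have hleft : CliffordAlgebra.contractLeft φ (ExteriorAlgebra.ι R a * z) =
        y r • z - ExteriorAlgebra.ι R a * CliffordAlgebra.contractLeft φ z := by
      rw [← ha]
      exact CliffordAlgebra.contractLeft_ι_mul (Q := 0) φ a z
    have hmul : ExteriorAlgebra.ι R a * CliffordAlgebra.contractLeft φ z ∈
        J • (⊤ : Submodule R (ExteriorAlgebra R (Fin N → R))) :=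
      map_mem_ideal_smul_top (LinearMap.mulLeft R (ExteriorAlgebra.ι R a)) hdz
    have hmem : ExteriorAlgebra.ι R a * z ∈ ⋀[R]^(i + 1) (Fin N → R) := by
      rw [ExteriorAlgebra.exteriorPower, pow_succ']
      exact Submodule.mul_mem_mul (LinearMap.mem_range_self _ a) hz
    obtain ⟨w, hw⟩ := ih (i + 1) (by omega) _ hmem (by
      rw [hleft, Submodule.sup_smul]
      refine Submodule.sub_mem _ (Submodule.mem_sup_left ?_) (Submodule.mem_sup_right hmul)
      exact Submodule.smul_mem_smul (Ideal.mem_span_singleton_self _) trivial)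
    rw [Submodule.sup_smul, Submodule.ideal_span_singleton_smul, Submodule.mem_sup] at hw
    obtain ⟨_, hv, u, hu, hvu⟩ := hw
    obtain ⟨v, -, rfl⟩ := hv
    refine ⟨v, ?_⟩
    -- Contract the equation `y r • v + u = a * z - dw`, with `d` the contraction. The term `dw`
    -- dies since `d` squares to zero, and the terms other than `y r • z` and `y r • dv` lie in `J`.
    have h1 : y r • (z - CliffordAlgebra.contractLeft φ v) ∈
        J • (⊤ : Submodule R (ExteriorAlgebra R (Fin N → R))) := by
      have h2 := congrArg (CliffordAlgebra.contractLeft φ) hvu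
      rw [map_add, map_sub, CliffordAlgebra.contractLeft_contractLeft, hleft, sub_zero,
        DistribSMul.toLinearMap_apply, map_smul] at h2
      have h3 : y r • (z - CliffordAlgebra.contractLeft φ v) =
          CliffordAlgebra.contractLeft φ u +
            ExteriorAlgebra.ι R a * CliffordAlgebra.contractLeft φ z := by
        rw [smul_sub, sub_eq_iff_eq_add, add_right_comm, eq_comm]
        rw [eq_sub_iff_add_eq] at h2
        rw [← h2]
        abel
      rw [h3]
      exact Submodule.add_mem _ (map_mem_ideal_smul_top _ hu) hmul
    -- The exterior algebra is free, so `y r` can be cancelled modulo `J` coordinate by coordinate.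
    have B := (Pi.basisFun R (Fin N)).ExteriorAlgebra
    rw [mem_ideal_smul_top_iff_repr B] at h1 ⊢
    intro j
    refine hy r hr _ ?_
    have := h1 j
    rwa [map_smul, Finsupp.smul_apply, smul_eq_mul] at this

/-- `toTrivSqZeroExt` keeps only degrees zero and one, and contraction lowers the degree by one.
This supplies the scalar factor when the contraction of a product is expanded in degree one. -/
theorem fst_contractLeft {N : ℕ} (φ : Module.Dual R (Fin N → R))
    (w : ExteriorAlgebra R (Fin N → R)) :
    (ExteriorAlgebra.toTrivSqZeroExt (CliffordAlgebra.contractLeft φ w)).fst =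
      φ (ExteriorAlgebra.toTrivSqZeroExt w).snd := by
  induction w using CliffordAlgebra.left_induction with
  | algebraMap r =>
    rw [CliffordAlgebra.contractLeft_algebraMap]
    have := AlgHom.commutes (ExteriorAlgebra.toTrivSqZeroExt (R := R) (M := Fin N → R)) r
    erw [this]
    simp [TrivSqZeroExt.algebraMap_eq_inl]
  | add x y hx hy => simp only [map_add, TrivSqZeroExt.fst_add, TrivSqZeroExt.snd_add, hx, hy]
  | ι_mul x a _ =>
    have h1 : ExteriorAlgebra.toTrivSqZeroExt (CliffordAlgebra.ι (0 : QuadraticForm R (Fin N → R)) a)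
      = TrivSqZeroExt.inr a := ExteriorAlgebra.toTrivSqZeroExt_ι a
    rw [CliffordAlgebra.contractLeft_ι_mul, map_sub, map_smul, map_mul, map_mul, h1]
    simp [mul_comm]

/-- Every Koszul boundary of degree one is given by an alternating matrix. -/
theorem exists_antisymm_snd_contractLeft {N : ℕ} (P : Fin N → R)
    (w : ExteriorAlgebra R (Fin N → R)) :
    ∃ s : Fin N → Fin N → R, (∀ i j, s i j = - s j i) ∧
      ∀ i, (ExteriorAlgebra.toTrivSqZeroExt
        (CliffordAlgebra.contractLeft (Fintype.linearCombination R P) w)).snd i =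
          ∑ j, s i j * P j := by
  induction w using CliffordAlgebra.left_induction with
  | algebraMap r =>
    refine ⟨0, by simp, fun i => ?_⟩
    rw [CliffordAlgebra.contractLeft_algebraMap]
    simp
  | add x y hx hy =>
    obtain ⟨s, hs, hx⟩ := hx
    obtain ⟨t, ht, hy⟩ := hy
    refine ⟨s + t, fun i j => ?_, fun i => ?_⟩
    · simp only [Pi.add_apply]
      rw [hs i j, ht i j]
      ring
    · simp only [map_add, TrivSqZeroExt.snd_add, Pi.add_apply, hx, hy, add_mul,
        Finset.sum_add_distrib]
  | ι_mul x a _ =>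
    have h1 : ExteriorAlgebra.toTrivSqZeroExt (CliffordAlgebra.ι (0 : QuadraticForm R (Fin N → R)) a)
      = TrivSqZeroExt.inr a := ExteriorAlgebra.toTrivSqZeroExt_ι a
    set v := (ExteriorAlgebra.toTrivSqZeroExt x).snd with hv
    -- With `φ` the functional given by `P`, the degree-one part of the contraction of `a * x` is `φ
    -- a • v - φ v • a`; expanding `φ` gives this matrix. No induction hypothesis is needed.
    refine ⟨fun i j => v i * a j - v j * a i, fun i j => by ring, fun i => ?_⟩
    rw [CliffordAlgebra.contractLeft_ι_mul, map_sub, map_smul, map_mul, h1]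
    simp only [TrivSqZeroExt.snd_sub, TrivSqZeroExt.snd_smul, TrivSqZeroExt.snd_mul,
      TrivSqZeroExt.fst_inr, TrivSqZeroExt.snd_inr, zero_smul, zero_add, Pi.sub_apply,
      Pi.smul_apply, op_smul_eq_smul, fst_contractLeft, smul_eq_mul, ← hv,
      Fintype.linearCombination_apply, Finset.sum_mul, sub_mul, Finset.sum_sub_distrib]
    congr 1 <;> exact Finset.sum_congr rfl fun j _ => by ring

/-- If the ideal generated by `P 0, …, P (N - 1)` contains a regular sequence of length `N`, then
the syzygies of `P` are the trivial ones. -/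
theorem exists_antisymm_of_sum_eq_zero [Nontrivial R] {N : ℕ} (P : Fin N → R) (y : ℕ → R)
    (hy : ∀ r < N, ∀ p, y r * p ∈ Ideal.span (y '' Set.Iio r) → p ∈ Ideal.span (y '' Set.Iio r))
    (hP : ∀ r < N, y r ∈ Ideal.span (Set.range P)) (b : Fin N → R)
    (hb : ∑ i, b i * P i = 0) :
    ∃ s : Fin N → Fin N → R, (∀ i j, s i j = - s j i) ∧ ∀ i, b i = ∑ j, s i j * P j := by
  have hd : CliffordAlgebra.contractLeft (Fintype.linearCombination R P)
      (ExteriorAlgebra.ι R b) = 0 := by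
    refine (CliffordAlgebra.contractLeft_ι 0 (Fintype.linearCombination R P) b).trans ?_
    rw [Fintype.linearCombination_apply]
    simp [hb]
  obtain ⟨w, hw⟩ := koszul_exact_mod (Fintype.linearCombination R P) y hy (fun r hr => by
    obtain ⟨c, hc⟩ := (Ideal.mem_span_range_iff_exists_fun).1 (hP r hr)
    exact ⟨c, by simpa [Fintype.linearCombination_apply] using hc⟩) (Nat.zero_le N) 1 one_pos
    (ExteriorAlgebra.ι R b) (by
      rw [ExteriorAlgebra.exteriorPower, pow_one]
      exact LinearMap.mem_range_self _ b) (by rw [hd]; exact Submodule.zero_mem _)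
  have h0 : Ideal.span (y '' Set.Iio 0) = ⊥ := by simp
  rw [h0, Submodule.bot_smul, Submodule.mem_bot, sub_eq_zero] at hw
  obtain ⟨s, hs, h⟩ := exists_antisymm_snd_contractLeft P w
  refine ⟨s, hs, fun i => ?_⟩
  rw [← h i, ← hw, ExteriorAlgebra.toTrivSqZeroExt_ι, TrivSqZeroExt.snd_inr]

end Koszul

/-! ### Homogeneous components and homogeneous ideals. -/

section HomogeneousComponents

variable {σ L : Type*} [Field L]

/-- The homogeneous component of integer degree `k` of a polynomial. -/
def homogComp (k : ℤ) : MvPolynomial σ L →ₗ[L] MvPolynomial σ L :=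
  if 0 ≤ k then homogeneousComponent k.toNat else 0

theorem coeff_homogComp (k : ℤ) (p : MvPolynomial σ L) (s : σ →₀ ℕ) :
    coeff s (homogComp k p) = if (s.degree : ℤ) = k then coeff s p else 0 := by
  unfold homogComp
  split_ifs with h h' h'
  · rw [coeff_homogeneousComponent, if_pos (by omega)]
  · rw [coeff_homogeneousComponent, if_neg (by omega)]
  · omega
  · simp

theorem homogComp_mem (k : ℤ) (p : MvPolynomial σ L) : homogComp k p ∈ homogPoly σ L k := by
  intro s hs
  rw [coeff_homogComp] at hs
  by_contra h
  exact hs (if_neg h)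

theorem homogComp_of_mem {j : ℤ} {p : MvPolynomial σ L} (hp : p ∈ homogPoly σ L j) (k : ℤ) :
    homogComp k p = if j = k then p else 0 := by
  ext s
  rw [coeff_homogComp]
  by_cases h : coeff s p = 0
  · split_ifs <;> simp [h]
  · rw [hp s h]
    split_ifs <;> simp

/-- This allows the coefficients of a relation among homogeneous polynomials to be replaced by
homogeneous ones. Integer degrees avoid truncation in `k - e`. -/
theorem homogComp_mul {e : ℤ} {q : MvPolynomial σ L} (hq : q ∈ homogPoly σ L e) (k : ℤ)
    (p : MvPolynomial σ L) : homogComp k (p * q) = homogComp (k - e) p * q := by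
  classical
  ext s
  rw [coeff_homogComp, coeff_mul, coeff_mul, ← boole_mul, Finset.mul_sum]
  refine Finset.sum_congr rfl fun x hx => ?_
  rw [coeff_homogComp, boole_mul]
  by_cases h : coeff x.2 q = 0
  · simp [h]
  · have h1 := hq _ h
    rw [Finset.HasAntidiagonal.mem_antidiagonal] at hx
    have h2 : (s.degree : ℤ) = x.1.degree + e := by
      rw [← hx, map_add, ← h1]
      push_cast
      rfl
    rw [h2]
    by_cases h3 : (x.1.degree : ℤ) = k - e
    · rw [if_pos (by linarith), if_pos h3]
    · rw [if_neg (fun h => h3 (by linarith)), if_neg h3, zero_mul]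

theorem eq_zero_of_mem_homogPoly_neg {k : ℤ} (hk : k < 0) {p : MvPolynomial σ L}
    (hp : p ∈ homogPoly σ L k) : p = 0 := by
  ext s
  by_contra h
  have := hp s h
  omega

theorem X_mem_homogPoly (i : σ) : (X i : MvPolynomial σ L) ∈ homogPoly σ L 1 :=
  mem_homogPoly_natCast.2 (isHomogeneous_X L i)

theorem pow_mem_homogPoly {e : ℤ} {p : MvPolynomial σ L} (hp : p ∈ homogPoly σ L e) (k : ℕ) :
    p ^ k ∈ homogPoly σ L (k * e) := by
  induction k with
  | zero => simpa using mem_homogPoly_natCast.2 (isHomogeneous_one σ L)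
  | succ k ih =>
    rw [pow_succ]
    convert mul_mem_homogPoly ih hp using 2
    push_cast
    ring

theorem exists_homogPoly_of_mem_span {ι : Type*} [Fintype ι] {e k : ℤ}
    {P : ι → MvPolynomial σ L} (hP : ∀ i, P i ∈ homogPoly σ L e) {p : MvPolynomial σ L}
    (hp : p ∈ Ideal.span (Set.range P)) (hpk : p ∈ homogPoly σ L k) :
    ∃ c : ι → MvPolynomial σ L, (∀ i, c i ∈ homogPoly σ L (k - e)) ∧ p = ∑ i, c i * P i := by
  obtain ⟨c, hc⟩ := Ideal.mem_span_range_iff_exists_fun.1 hp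
  refine ⟨fun i => homogComp (k - e) (c i), fun i => homogComp_mem _ _, ?_⟩
  have h := homogComp_of_mem hpk k
  rw [if_pos rfl] at h
  rw [← h, ← hc, map_sum]
  exact Finset.sum_congr rfl fun i _ => homogComp_mul (hP i) k (c i)

theorem homogComp_mem_span {ι : Type*} [Fintype ι] {e : ℤ} {P : ι → MvPolynomial σ L}
    (hP : ∀ i, P i ∈ homogPoly σ L e) {p : MvPolynomial σ L}
    (hp : p ∈ Ideal.span (Set.range P)) (k : ℤ) :
    homogComp k p ∈ Ideal.span (Set.range P) := by
  obtain ⟨c, rfl⟩ := Ideal.mem_span_range_iff_exists_fun.1 hp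
  rw [map_sum]
  refine Ideal.sum_mem _ fun i _ => ?_
  rw [homogComp_mul (hP i)]
  exact Ideal.mul_mem_left _ _ (Ideal.subset_span ⟨i, rfl⟩)

/-- The class of `X i` is integral over `L`, so a monic polynomial in `X i` lies in the ideal. The
ideal is homogeneous, hence contains the top component, which is a pure power of `X i`. -/
theorem exists_X_pow_mem_span {ι : Type*} [Fintype ι] {e : ℤ} {P : ι → MvPolynomial σ L}
    (hP : ∀ i, P i ∈ homogPoly σ L e)
    (hfin : Module.Finite L (MvPolynomial σ L ⧸ Ideal.span (Set.range P))) (i : σ) :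
    ∃ M : ℕ, (X i : MvPolynomial σ L) ^ M ∈ Ideal.span (Set.range P) := by
  set I := Ideal.span (Set.range P)
  obtain ⟨q, hq, hq0⟩ := Algebra.IsIntegral.isIntegral (R := L) (Ideal.Quotient.mk I (X i))
  have h1 : Polynomial.aeval (X i : MvPolynomial σ L) q ∈ I := by
    rw [← Ideal.Quotient.eq_zero_iff_mem, ← hq0]
    exact (Polynomial.aeval_algHom_apply (Ideal.Quotient.mkₐ L I) (X i) q).symm
  refine ⟨q.natDegree, ?_⟩
  have h2 := homogComp_mem_span hP h1 q.natDegree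
  rw [Polynomial.aeval_eq_sum_range, map_sum, Finset.sum_range_succ, Finset.sum_eq_zero] at h2
  · have h3 := homogComp_of_mem (pow_mem_homogPoly (X_mem_homogPoly (L := L) i) q.natDegree)
      (q.natDegree : ℤ)
    rw [mul_one, if_pos rfl] at h3
    rwa [zero_add, map_smul, h3, hq.coeff_natDegree, one_smul] at h2
  · intro j hj
    rw [Finset.mem_range] at hj
    rw [map_smul, homogComp_of_mem (pow_mem_homogPoly (X_mem_homogPoly i) j), if_neg, smul_zero]
    omega

end HomogeneousComponents

/-! ### Triviality of homogeneous syzygies. -/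

section Syzygies

variable {L : Type*} [Field L] {N : ℕ}

/-- Powers of the variables form a regular sequence. -/
theorem mem_span_X_pow_of_mul_mem (M : Fin N → ℕ) (y : ℕ → MvPolynomial (Fin N) L)
    (hy : ∀ i : Fin N, y i = X i ^ M i) {r : ℕ} (hr : r < N) (p : MvPolynomial (Fin N) L)
    (hp : y r * p ∈ Ideal.span (y '' Set.Iio r)) : p ∈ Ideal.span (y '' Set.Iio r) := by
  have himage : y '' Set.Iio r = (fun s => monomial s (1 : L)) ''
      ((fun i : Fin N => Finsupp.single i (M i)) '' {i | (i : ℕ) < r}) := by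
    rw [Set.image_image]
    ext q
    constructor
    · rintro ⟨j, hj, rfl⟩
      rw [Set.mem_Iio] at hj
      refine ⟨⟨j, lt_trans hj hr⟩, hj, ?_⟩
      exact X_pow_eq_monomial.symm.trans (hy ⟨j, lt_trans hj hr⟩).symm
    · rintro ⟨i, hi, rfl⟩
      exact ⟨i, hi, by rw [hy, X_pow_eq_monomial]⟩
  rw [himage, mem_ideal_span_monomial_image] at hp ⊢
  intro s hs
  have h1 : y r = monomial (Finsupp.single ⟨r, hr⟩ (M ⟨r, hr⟩)) 1 := by
    rw [← X_pow_eq_monomial, ← hy]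
  obtain ⟨_, ⟨i, hi, rfl⟩, h2⟩ := hp (Finsupp.single ⟨r, hr⟩ (M ⟨r, hr⟩) + s) (by
    rw [h1, mem_support_iff, coeff_monomial_mul, one_mul]
    exact mem_support_iff.1 hs)
  refine ⟨_, ⟨i, hi, rfl⟩, ?_⟩
  rw [Finsupp.single_le_iff] at h2 ⊢
  -- The generators of the monomial ideal involve only variables before `X r`, so the factor `y r`
  -- does not help a monomial to be divisible by one of them.
  have h3 : (⟨r, hr⟩ : Fin N) ≠ i := by
    rintro rfl
    exact lt_irrefl r hi
  simpa [Finsupp.single_apply, h3] using h2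

/-- The syzygies of as many homogeneous polynomials as there are variables, whose quotient ring
is finite-dimensional, are trivial. -/
theorem exists_homogPoly_antisymm {P : Fin N → MvPolynomial (Fin N) L} {e k : ℤ}
    (hP : ∀ i, P i ∈ homogPoly (Fin N) L e)
    (hfin : Module.Finite L (MvPolynomial (Fin N) L ⧸ Ideal.span (Set.range P)))
    (b : Fin N → MvPolynomial (Fin N) L) (hbk : ∀ i, b i ∈ homogPoly (Fin N) L k)
    (hb : ∑ i, b i * P i = 0) :
    ∃ s : Fin N → Fin N → MvPolynomial (Fin N) L, (∀ i j, s i j ∈ homogPoly (Fin N) L (k - e)) ∧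
      (∀ i j, s i j = - s j i) ∧ ∀ i, b i = ∑ j, s i j * P j := by
  choose M hM using exists_X_pow_mem_span (L := L) hP hfin
  -- The value `0` from `N` on is a filler: only indices below `N` enter.
  set y : ℕ → MvPolynomial (Fin N) L := fun r => if h : r < N then X ⟨r, h⟩ ^ M ⟨r, h⟩ else 0
    with hydef
  have hy : ∀ i : Fin N, y i = X i ^ M i := fun i => by simp [hydef]
  obtain ⟨s, hs, h⟩ := exists_antisymm_of_sum_eq_zero P y
    (fun r hr p => mem_span_X_pow_of_mul_mem M y hy hr p)
    (fun r hr => by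
      have := hM ⟨r, hr⟩
      rwa [← hy] at this) b hb
  refine ⟨fun i j => homogComp (k - e) (s i j), fun i j => homogComp_mem _ _, fun i j => ?_,
    fun i => ?_⟩
  · dsimp only
    rw [hs i j, map_neg]
  · have h1 := homogComp_of_mem (hbk i) k
    rw [if_pos rfl] at h1
    rw [← h1, h i, map_sum]
    exact Finset.sum_congr rfl fun j _ => homogComp_mul (hP j) k _

end Syzygies

/-! ### Calculus of fractions with denominator a power of `f`. -/

section FractionCalculus

variable {σ L : Type*} [Field L] (f : MvPolynomial σ L)

theorem frac_eq_mul (a : MvPolynomial σ L) (l : ℕ) :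
    frac f a l = algebraMap _ (FracRing f) a * frac f 1 l := by
  rw [frac_eq_iff, mul_assoc, frac_mul_pow, map_one, mul_one]

/-- The map `a ↦ a / f ^ l`, as a linear map. -/
def fracLinear (l : ℕ) : MvPolynomial σ L →ₗ[L] FracRing f where
  toFun a := frac f a l
  map_add' a b := by rw [frac_eq_mul, map_add, add_mul, ← frac_eq_mul, ← frac_eq_mul]
  map_smul' c a := (smul_frac f a l c).symm

theorem frac_sum {ι : Type*} (s : Finset ι) (a : ι → MvPolynomial σ L) (l : ℕ) :
    frac f (∑ i ∈ s, a i) l = ∑ i ∈ s, frac f (a i) l :=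
  map_sum (fracLinear f l) a s

theorem frac_add_num (a b : MvPolynomial σ L) (l : ℕ) :
    frac f (a + b) l = frac f a l + frac f b l :=
  map_add (fracLinear f l) a b

theorem frac_sub_num (a b : MvPolynomial σ L) (l : ℕ) :
    frac f (a - b) l = frac f a l - frac f b l :=
  map_sub (fracLinear f l) a b

theorem frac_pow_mul (a : MvPolynomial σ L) (k l : ℕ) :
    frac f (f ^ k * a) (k + l) = frac f a l := by
  rw [frac_eq_iff, pow_add, map_mul, ← frac_mul_pow f a l, map_pow]
  ring

variable {f}

theorem frac_injective (hf0 : f ≠ 0) {a b : MvPolynomial σ L} {l : ℕ}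
    (h : frac f a l = frac f b l) : a = b := by
  rw [frac_eq_iff, frac_mul_pow] at h
  exact IsLocalization.injective (FracRing f)
    (powers_le_nonZeroDivisors_of_noZeroDivisors hf0 :
      Submonoid.powers f ≤ nonZeroDivisors (MvPolynomial σ L)) h

variable (f)

theorem pderiv_pderiv_comm (i j : σ) (p : MvPolynomial σ L) :
    pderiv i (pderiv j p) = pderiv j (pderiv i p) := by
  classical
  have h : ⁅(pderiv i : Derivation L (MvPolynomial σ L) (MvPolynomial σ L)),
      (pderiv j : Derivation L (MvPolynomial σ L) (MvPolynomial σ L))⁆ = 0 := by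
    apply MvPolynomial.derivation_ext
    intro k
    rw [Derivation.commutator_apply, pderiv_X, pderiv_X, Pi.single_apply, Pi.single_apply]
    split_ifs <;> simp
  have h1 := congrArg (fun D : Derivation L (MvPolynomial σ L) (MvPolynomial σ L) => D p) h
  simpa [Derivation.commutator_apply, sub_eq_zero] using h1

/-- The commutator is a derivation that kills polynomials, in particular `f ^ l` and `F * f ^ l`. By
the Leibniz rule `f ^ l` times its value at `F` is zero, and `f` is a unit. -/
theorem partialD_comm (i j : σ) (F : FracRing f) :
    partialD f i (partialD f j F) = partialD f j (partialD f i F) := by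
  have h (a : MvPolynomial σ L) :
      ⁅partialD f i, partialD f j⁆ (algebraMap _ (FracRing f) a) = 0 := by
    rw [Derivation.commutator_apply, partialD_algebraMap, partialD_algebraMap, partialD_algebraMap,
      partialD_algebraMap, pderiv_pderiv_comm, sub_self]
  obtain ⟨a, l, rfl⟩ := exists_frac f F
  have h1 := h a
  rw [← frac_mul_pow f a l, Derivation.leibniz, ← map_pow, h, smul_zero, zero_add, smul_eq_mul,
    map_pow, ((isUnit_algebraMap f).pow l).mul_right_eq_zero, Derivation.commutator_apply,
    sub_eq_zero] at h1
  exact h1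

theorem sum_antisymm_eq_zero [CharZero L] {ι E : Type*} [Fintype ι] [AddCommGroup E] [Module L E]
    (T : ι → ι → E) (hT : ∀ i j, T i j = - T j i) : ∑ i, ∑ j, T i j = 0 := by
  have h : ∑ i, ∑ j, T i j = - ∑ i, ∑ j, T i j := by
    conv_lhs => rw [Finset.sum_comm]
    rw [← Finset.sum_neg_distrib]
    refine Finset.sum_congr rfl fun i _ => ?_
    rw [← Finset.sum_neg_distrib]
    exact Finset.sum_congr rfl fun j _ => hT j i
  rw [eq_neg_iff_add_eq_zero, ← two_smul L] at h
  exact (smul_eq_zero.1 h).resolve_left two_ne_zero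

/-- The relation by which the order of the pole is reduced. -/
theorem smul_frac_mul_pderiv (a : MvPolynomial σ L) (i : σ) (l : ℕ) :
    (l : L) • frac f (a * pderiv i f) (l + 1) =
      frac f (pderiv i a) l - partialD f i (frac f a l) := by
  rw [partialD_frac, frac_sub_num, smul_frac, add_comm l 1]
  have := frac_pow_mul f (pderiv i a) 1 l
  rw [pow_one] at this
  rw [this, sub_sub_cancel]

theorem sum_X_mul_pderiv_of_mem [Fintype σ] {k : ℤ} {p : MvPolynomial σ L}
    (hp : p ∈ homogPoly σ L k) : ∑ i, X i * pderiv i p = (k : L) • p := by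
  rw [mem_homogPoly_iff] at hp
  rcases hp with rfl | ⟨m, rfl, hp⟩
  · simp
  · rw [hp.sum_X_mul_pderiv, Int.cast_natCast, Nat.cast_smul_eq_nsmul]

end FractionCalculus

/-! ### Exact fractions have numerators in the Jacobian ideal. -/

section PoleReduction

variable {L : Type*} [Field L] {n d : ℕ} {f : MvPolynomial (Fin (n + 1)) L}

/-- In either excluded case all partial derivatives vanish, so the Jacobian ideal is zero; yet it
must contain a power of `X 0`. -/
theorem degree_ne_zero_and_ne_zero (hf : f.IsHomogeneous d)
    (hH : Module.Finite L (JacobianRing f)) : d ≠ 0 ∧ f ≠ 0 := by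
  have hf' : f ∈ homogPoly (Fin (n + 1)) L (d : ℤ) := mem_homogPoly_natCast.2 hf
  have h : ¬ ∀ i, pderiv i f = 0 := by
    intro h
    obtain ⟨M, hM⟩ := exists_X_pow_mem_span (L := L) (P := fun i => pderiv i f)
      (fun i => pderiv_mem_homogPoly i hf') hH 0
    have h0 : Ideal.span (Set.range fun i => pderiv i f) = ⊥ := by
      rw [Ideal.span_eq_bot]
      rintro _ ⟨i, rfl⟩
      exact h i
    rw [h0, Ideal.mem_bot] at hM
    exact pow_ne_zero M (X_ne_zero 0) hM
  constructor
  · rintro rfl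
    exact h fun i => eq_zero_of_mem_homogPoly_neg (by simp) (pderiv_mem_homogPoly i hf')
  · rintro rfl
    exact h fun i => map_zero _

theorem self_mem_jacobianIdeal [CharZero L] (hf : f.IsHomogeneous d) (hd : d ≠ 0) :
    f ∈ jacobianIdeal f := by
  have h1 : (d : L) • f ∈ jacobianIdeal f := by
    rw [Nat.cast_smul_eq_nsmul, ← hf.sum_X_mul_pderiv]
    exact Ideal.sum_mem _ fun i _ => Ideal.mul_mem_left _ _ (Ideal.subset_span ⟨i, rfl⟩)
  have h2 := Submodule.smul_of_tower_mem (jacobianIdeal f) (d : L)⁻¹ h1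
  rwa [inv_smul_smul₀ (Nat.cast_ne_zero.2 hd)] at h2

theorem sum_partialD_frac (a : Fin (n + 1) → MvPolynomial (Fin (n + 1)) L) (m : ℕ) :
    ∑ i, partialD f i (frac f (a i) m) =
      frac f (f * ∑ i, pderiv i (a i) - (m : L) • ∑ i, a i * pderiv i f) (m + 1) := by
  simp only [partialD_frac, ← frac_sum, Finset.mul_sum, Finset.smul_sum, Finset.sum_sub_distrib]

/-- The Euler vector field times a fraction of degree `-n-1` is exact for the trivial reason. -/
theorem sum_partialD_frac_X_mul (hf : f.IsHomogeneous d) (m : ℕ)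
    {h : MvPolynomial (Fin (n + 1)) L}
    (hh : h ∈ homogPoly (Fin (n + 1)) L (-(n : ℤ) - 1 + m * d)) :
    ∑ i, partialD f i (frac f (X i * h) m) = 0 := by
  -- The Leibniz rule contributes `n + 1` and Euler's formula `-n - 1 + m d`. The remaining `m d`
  -- cancels against the derivative of the denominator.
  have h1 : ∑ i : Fin (n + 1), pderiv i (X i * h) = ((m : L) * d) • h := by
    simp only [Derivation.leibniz, pderiv_X_self, smul_eq_mul, mul_one, Finset.sum_add_distrib,
      sum_X_mul_pderiv_of_mem hh, Finset.sum_const, Finset.card_univ, Fintype.card_fin]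
    rw [← Nat.cast_smul_eq_nsmul L, ← add_smul]
    congr 1
    push_cast
    ring
  have h2 : ∑ i : Fin (n + 1), X i * h * pderiv i f = (d : L) • (h * f) := by
    rw [← mul_smul_comm, Nat.cast_smul_eq_nsmul, ← hf.sum_X_mul_pderiv, Finset.mul_sum]
    exact Finset.sum_congr rfl fun i _ => by ring
  rw [sum_partialD_frac, h1, h2, mul_smul_comm, smul_smul, mul_comm f h, sub_self, frac_zero]

/-- If the pole of `∑ i, ∂ᵢ (aᵢ / f ^ (t + 1))` has order less than `t + 2`, then this sum can be
written with fractions that have denominator `f ^ t`. -/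
theorem exists_lower_pole [CharZero L] (hn : 1 ≤ n) (hf : f.IsHomogeneous d)
    (hH : Module.Finite L (JacobianRing f)) (t : ℕ)
    (a : Fin (n + 1) → MvPolynomial (Fin (n + 1)) L)
    (ha : ∀ i, a i ∈ homogPoly (Fin (n + 1)) L (-(n : ℤ) + (t + 1 : ℕ) * d))
    (hdvd : f ∣ ∑ i, a i * pderiv i f) :
    ∃ a' : Fin (n + 1) → MvPolynomial (Fin (n + 1)) L,
      (∀ i, a' i ∈ homogPoly (Fin (n + 1)) L (-(n : ℤ) + t * d)) ∧
      ∑ i, partialD f i (frac f (a i) (t + 1)) = ∑ i, partialD f i (frac f (a' i) t) := by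
  obtain ⟨hd, -⟩ := degree_ne_zero_and_ne_zero hf hH
  have hdL : (d : L) ≠ 0 := Nat.cast_ne_zero.2 hd
  have hf' : f ∈ homogPoly (Fin (n + 1)) L (d : ℤ) := mem_homogPoly_natCast.2 hf
  have hP (i) : pderiv i f ∈ homogPoly (Fin (n + 1)) L ((d : ℤ) - 1) := pderiv_mem_homogPoly i hf'
  obtain ⟨h₀, hh₀⟩ := hdvd
  obtain ⟨h, hh, hah⟩ : ∃ h ∈ homogPoly (Fin (n + 1)) L (-(n : ℤ) - 1 + (t + 1 : ℕ) * d),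
      ∑ i, a i * pderiv i f = (d : L) • (h * f) := by
    -- Taking a component makes the quotient by `f` homogeneous; the factor `d⁻¹` matches the `d` in
    -- Euler's formula, so that `a i - X i * h` is a syzygy.
    refine ⟨(d : L)⁻¹ • homogComp (-(n : ℤ) - 1 + (t + 1 : ℕ) * d) h₀,
      Submodule.smul_mem _ _ (homogComp_mem _ _), ?_⟩
    have h1 : ∑ i, a i * pderiv i f ∈
        homogPoly (Fin (n + 1)) L (-(n : ℤ) - 1 + (t + 1 : ℕ) * d + d) := by
      refine Submodule.sum_mem _ fun i _ => ?_
      convert mul_mem_homogPoly (ha i) (hP i) using 2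
      ring
    have h2 := homogComp_of_mem h1 (-(n : ℤ) - 1 + (t + 1 : ℕ) * d + d)
    rw [if_pos rfl] at h2
    rw [← h2, hh₀, mul_comm f, homogComp_mul hf', add_sub_cancel_right, smul_mul_assoc, smul_inv_smul₀ hdL]
  obtain ⟨s, hs, hanti, hsum⟩ := exists_homogPoly_antisymm (P := fun i => pderiv i f) hP
    hH
    (k := -(n : ℤ) + (t + 1 : ℕ) * d) (fun i => a i - X i * h) (fun i => by
      refine Submodule.sub_mem _ (ha i) ?_
      convert mul_mem_homogPoly (X_mem_homogPoly i) hh using 2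
      ring) (by
      have h2 : ∑ i : Fin (n + 1), X i * h * pderiv i f = (d : L) • (h * f) := by
        rw [← mul_smul_comm, Nat.cast_smul_eq_nsmul, ← hf.sum_X_mul_pderiv, Finset.mul_sum]
        exact Finset.sum_congr rfl fun i _ => by ring
      simp only [sub_mul, Finset.sum_sub_distrib, hah, h2, sub_self])
  have hs' (i j) (k) : pderiv k (s i j) ∈ homogPoly (Fin (n + 1)) L (-(n : ℤ) + t * d) := by
    convert pderiv_mem_homogPoly k (hs i j) using 2
    push_cast
    ring
  have hsplit : ∑ i, partialD f i (frac f (a i) (t + 1)) =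
      ∑ i, ∑ j, partialD f i (frac f (s i j * pderiv j f) (t + 1)) := by
    rw [← zero_add (∑ i, ∑ j, _), ← sum_partialD_frac_X_mul hf (t + 1) hh,
      ← Finset.sum_add_distrib]
    refine Finset.sum_congr rfl fun i _ => ?_
    rw [← map_sum, ← frac_sum, ← map_add, ← frac_add_num, ← hsum i, add_sub_cancel]
  rw [hsplit]
  rcases Nat.eq_zero_or_pos t with rfl | ht
  -- For `t = 0` division by `t` is impossible, but `s i j` has degree `1 - n ≤ 0`, so its
  -- derivatives vanish. What is left is `s i j` times an expression symmetric in `i` and `j`.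
  · refine ⟨0, fun i => Submodule.zero_mem _, ?_⟩
    simp only [Pi.zero_apply, frac_zero, map_zero, Finset.sum_const_zero]
    apply sum_antisymm_eq_zero (L := L)
    intro i j
    have hzero (i j k) : pderiv k (s i j) = 0 :=
      eq_zero_of_mem_homogPoly_neg (by push_cast; omega) (hs' i j k)
    rw [partialD_frac, partialD_frac, eq_neg_iff_add_eq_zero, ← frac_add_num, ← frac_zero f (0 + 1 + 1)]
    congr 1
    rw [Derivation.leibniz, Derivation.leibniz, hzero, hzero, hanti j i, pderiv_pderiv_comm j i]
    simp only [smul_eq_mul, zero_add, Nat.cast_one, one_smul]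
    ring
  · have htL : (t : L) ≠ 0 := Nat.cast_ne_zero.2 ht.ne'
    refine ⟨fun i => (t : L)⁻¹ • ∑ j, pderiv j (s i j),
      fun i => Submodule.smul_mem _ _ (Submodule.sum_mem _ fun j _ => hs' i j j), ?_⟩
    -- An alternating matrix is paired with commuting derivatives.
    have hzero : ∑ i, ∑ j, partialD f i (partialD f j (frac f (s i j) t)) = 0 := by
      apply sum_antisymm_eq_zero (L := L)
      intro i j
      have : frac f (s i j) t = - frac f (s j i) t := by
        rw [hanti i j]
        exact map_neg (fracLinear f t) _
      rw [this, map_neg, map_neg, partialD_comm]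
    have h3 : ∑ i, ∑ j, partialD f i (frac f (s i j * pderiv j f) (t + 1)) =
        (t : L)⁻¹ • (∑ i, ∑ j, partialD f i (frac f (pderiv j (s i j)) t) -
          ∑ i, ∑ j, partialD f i (partialD f j (frac f (s i j) t))) := by
      simp only [← Finset.sum_sub_distrib, Finset.smul_sum]
      refine Finset.sum_congr rfl fun i _ => Finset.sum_congr rfl fun j _ => ?_
      rw [← map_sub, ← smul_frac_mul_pderiv, Derivation.map_smul, inv_smul_smul₀ htL]
    rw [h3, hzero, sub_zero, Finset.smul_sum]
    refine Finset.sum_congr rfl fun i _ => ?_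
    rw [← smul_frac, Derivation.map_smul, frac_sum, map_sum]

/-- Induction on the pole order `m`. Either the sum has formal pole order at most `k` and `g` is
read off from the numerators, or `f` must divide `∑ aᵢ ∂ᵢ f` and the pole can be lowered. -/
theorem mem_jacobianIdeal_of_frac_eq_sum [CharZero L] (hn : 1 ≤ n) (hf : f.IsHomogeneous d)
    (hH : Module.Finite L (JacobianRing f)) (g : MvPolynomial (Fin (n + 1)) L) (k m : ℕ)
    (a : Fin (n + 1) → MvPolynomial (Fin (n + 1)) L)
    (ha : ∀ i, a i ∈ homogPoly (Fin (n + 1)) L (-(n : ℤ) + m * d))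
    (hg : frac f g k = ∑ i, partialD f i (frac f (a i) m)) : g ∈ jacobianIdeal f := by
  obtain ⟨hd, hf0⟩ := degree_ne_zero_and_ne_zero hf hH
  induction m generalizing a with
  | zero =>
    have h0 (i) : a i = 0 := eq_zero_of_mem_homogPoly_neg (by push_cast; omega) (ha i)
    simp only [h0, frac_zero, map_zero, Finset.sum_const_zero] at hg
    rw [← frac_zero f k] at hg
    rw [frac_injective hf0 hg]
    exact Ideal.zero_mem _
  | succ m ih =>
    have hg' := hg
    rw [sum_partialD_frac] at hg'
    rcases le_or_gt (m + 1 + 1) k with hk | hk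
    · obtain ⟨c, rfl⟩ := Nat.exists_eq_add_of_le' hk
      rw [← frac_pow_mul f _ c (m + 1 + 1)] at hg'
      rw [frac_injective hf0 hg']
      refine Ideal.mul_mem_left _ _ (Ideal.sub_mem _
        (Ideal.mul_mem_right _ _ (self_mem_jacobianIdeal hf hd))
        (Submodule.smul_of_tower_mem _ _ (Ideal.sum_mem _ fun i _ => ?_)))
      exact Ideal.mul_mem_left _ _ (Ideal.subset_span ⟨i, rfl⟩)
    · obtain ⟨c, hc⟩ := Nat.exists_eq_add_of_lt hk
      rw [show m + 1 + 1 = c + 1 + k by omega, ← frac_pow_mul f g (c + 1) k] at hg'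
      have h1 := frac_injective hf0 hg'
      have h2 : f ∣ ((m + 1 : ℕ) : L) • ∑ i, a i * pderiv i f := by
        rw [eq_sub_iff_add_eq, ← eq_sub_iff_add_eq'] at h1
        rw [h1, pow_succ', mul_assoc, ← mul_sub]
        exact dvd_mul_right _ _
      have h3 : f ∣ ∑ i, a i * pderiv i f := by
        have h4 := dvd_smul_of_dvd ((m + 1 : ℕ) : L)⁻¹ h2
        rwa [inv_smul_smul₀ (Nat.cast_ne_zero.2 m.succ_ne_zero)] at h4
      obtain ⟨a', ha', h5⟩ := exists_lower_pole hn hf hH m a ha h3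
      exact ih a' ha' (hg.trans h5)

theorem exists_frac_of_le (hf : f.IsHomogeneous d) {p : ℤ} {F : FracRing f}
    (hF : F ∈ homogFrac hf p) : ∃ l : ℕ, ∀ m, l ≤ m →
      ∃ a ∈ homogPoly (Fin (n + 1)) L (p + m * d), F = frac f a m := by
  obtain ⟨l, a, ha, rfl⟩ := hF
  refine ⟨l, fun m hm => ?_⟩
  obtain ⟨c, rfl⟩ := Nat.exists_eq_add_of_le' hm
  refine ⟨f ^ c * a, ?_, (frac_pow_mul f a c l).symm⟩
  convert mul_mem_homogPoly (pow_mem_homogPoly (mem_homogPoly_natCast.2 hf) c) ha using 2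
  push_cast
  ring

theorem mem_jacobianIdeal_of_frac_mem_exactPart [CharZero L] (hn : 1 ≤ n) (hf : f.IsHomogeneous d)
    (hH : Module.Finite L (JacobianRing f)) {g : MvPolynomial (Fin (n + 1)) L} {k : ℕ}
    (hg : frac f g k ∈ exactPart hf) : g ∈ jacobianIdeal f := by
  obtain ⟨A, hA, hgA⟩ := hg
  choose l hl using fun i => exists_frac_of_le hf (hA i)
  choose a ha hAa using fun i => hl i (Finset.univ.sup l) (Finset.le_sup (Finset.mem_univ i))
  exact mem_jacobianIdeal_of_frac_eq_sum hn hf hH g k _ a ha (by simp only [← hAa, hgA])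

end PoleReduction

/-! ### Spanning and linear independence. -/

section Basis

variable {L : Type*} [Field L] {n d : ℕ} {f : MvPolynomial (Fin (n + 1)) L}

/-- Reduction of the order of the pole: a fraction whose numerator lies in the Jacobian ideal is,
modulo exact fractions, a fraction with a pole of smaller order. -/
theorem exists_frac_sub_mem_exactPart [CharZero L] (hn : 1 ≤ n) (hf : f.IsHomogeneous d) (l : ℕ)
    {a : MvPolynomial (Fin (n + 1)) L}
    (ha : a ∈ homogPoly (Fin (n + 1)) L (((l + 1 : ℕ) : ℤ) * d - (n + 1)))
    (haJ : a ∈ jacobianIdeal f) :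
    ∃ a' ∈ homogPoly (Fin (n + 1)) L ((l : ℤ) * d - (n + 1)),
      frac f a (l + 1) - frac f a' l ∈ exactPart hf := by
  have hf' : f ∈ homogPoly (Fin (n + 1)) L (d : ℤ) := mem_homogPoly_natCast.2 hf
  obtain ⟨c, hc, rfl⟩ := exists_homogPoly_of_mem_span
    (fun i => pderiv_mem_homogPoly i hf') haJ ha
  have hc' (i) : c i ∈ homogPoly (Fin (n + 1)) L (-(n : ℤ) + l * d) := by
    convert hc i using 2
    push_cast
    ring
  rcases Nat.eq_zero_or_pos l with rfl | hl
  -- At a simple pole the coefficients have degree `-n < 0`, so the fraction is already zero.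
  · have h0 (i) : c i = 0 := eq_zero_of_mem_homogPoly_neg (by push_cast; omega) (hc' i)
    refine ⟨0, Submodule.zero_mem _, ?_⟩
    simp only [h0, zero_mul, Finset.sum_const_zero, frac_zero, sub_zero]
    exact Submodule.zero_mem _
  · have hlL : (l : L) ≠ 0 := Nat.cast_ne_zero.2 hl.ne'
    refine ⟨(l : L)⁻¹ • ∑ i, pderiv i (c i),
      Submodule.smul_mem _ _ (Submodule.sum_mem _ fun i _ => ?_),
      fun i => frac f (-(l : L)⁻¹ • c i) l,
      fun i => frac_mem_homogFrac hf (Submodule.smul_mem _ _ (hc' i)), ?_⟩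
    · convert pderiv_mem_homogPoly i (hc' i) using 2
      ring
    · rw [← smul_frac, frac_sum, frac_sum, Finset.smul_sum, ← Finset.sum_sub_distrib]
      refine Finset.sum_congr rfl fun i _ => ?_
      dsimp only
      rw [← smul_frac, Derivation.map_smul, neg_smul, eq_neg_iff_add_eq_zero, sub_add,
        ← smul_sub, ← smul_frac_mul_pderiv, inv_smul_smul₀ hlL, sub_self]

variable (g : (l : ℕ+) → Fin (Module.finrank L (jacobianA f d l)) → MvPolynomial (Fin (n + 1)) L)
  (b : (l : ℕ+) → Module.Basis (Fin (Module.finrank L (jacobianA f d l))) L (jacobianA f d l))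

/-- Induction on the pole order: the basis of `A_l` corrects the numerator to one in Jac f, whose
fraction has a smaller pole modulo exact ones. At order zero the numerator has negative degree. -/
theorem homogFrac_le_span_sup_exactPart [CharZero L] (hn : 1 ≤ n) (hf : f.IsHomogeneous d)
    (hg : ∀ (l : ℕ+) i, g l i ∈
      homogPoly (Fin (n + 1)) L (((l : ℕ) : ℤ) * d - (n + 1)))
    (hb : ∀ l i, (b l i : JacobianRing f) = Ideal.Quotient.mk (jacobianIdeal f) (g l i)) :
    homogFrac hf (-(n : ℤ) - 1) ≤
      Submodule.span L (Set.range
        fun x : (l : ℕ+) × Fin (Module.finrank L (jacobianA f d l)) =>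
          frac f (g x.1 x.2) x.1) ⊔ exactPart hf := by
  set S := Submodule.span L (Set.range
    fun x : (l : ℕ+) × Fin (Module.finrank L (jacobianA f d l)) => frac f (g x.1 x.2) x.1)
  have key (l : ℕ) : ∀ a ∈ homogPoly (Fin (n + 1)) L ((l : ℤ) * d - (n + 1)),
      frac f a l ∈ S ⊔ exactPart hf := by
    induction l with
    | zero =>
      intro a ha
      rw [eq_zero_of_mem_homogPoly_neg (by push_cast; omega) ha, frac_zero]
      exact Submodule.zero_mem _
    | succ l ih =>
      intro a ha
      let k : ℕ+ := ⟨l + 1, l.succ_pos⟩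
      let v : jacobianA f d k := ⟨Ideal.Quotient.mk (jacobianIdeal f) a, a, ha, rfl⟩
      set a₁ := ∑ i, (b k).repr v i • g k i with ha₁
      have h1 : a - a₁ ∈ jacobianIdeal f := by
        rw [← Ideal.Quotient.eq_zero_iff_mem, map_sub, sub_eq_zero]
        have h2 := congrArg (Submodule.subtype _) ((b k).sum_repr v)
        rw [map_sum] at h2
        refine Eq.trans h2.symm ?_
        rw [ha₁, map_sum]
        refine Finset.sum_congr rfl fun i _ => ?_
        rw [map_smul, Submodule.subtype_apply, hb]
        rfl
      have h3 : a₁ ∈ homogPoly (Fin (n + 1)) L (((l + 1 : ℕ) : ℤ) * d - (n + 1)) :=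
        Submodule.sum_mem _ fun i _ => Submodule.smul_mem _ _ (hg k i)
      obtain ⟨a', ha', h4⟩ := exists_frac_sub_mem_exactPart hn hf l (Submodule.sub_mem _ ha h3) h1
      have h5 : frac f a (l + 1) = frac f a₁ (l + 1) +
          (frac f a' l + (frac f (a - a₁) (l + 1) - frac f a' l)) := by
        rw [frac_sub_num]
        abel
      rw [h5]
      refine Submodule.add_mem _ (Submodule.mem_sup_left ?_)
        (Submodule.add_mem _ (ih a' ha') (Submodule.mem_sup_right h4))
      rw [ha₁, frac_sum]
      refine Submodule.sum_mem _ fun i _ => ?_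
      rw [← smul_frac]
      exact Submodule.smul_mem _ _ (Submodule.subset_span ⟨⟨k, i⟩, rfl⟩)
  rintro _ ⟨l, a, ha, rfl⟩
  refine key l a ?_
  convert ha using 2
  ring

/-- Put the combination over `f ^ k`, with `k` the largest pole order that occurs. The numerator
lies in Jac f, and the terms of smaller order carry a factor `f`, which also lies there. The terms
of order `k` thus give a relation in the basis of `A_k`. -/
theorem eq_zero_of_sum_mem_exactPart [CharZero L] (hn : 1 ≤ n) (hf : f.IsHomogeneous d)
    (hH : Module.Finite L (JacobianRing f))
    (hb : ∀ l i, (b l i : JacobianRing f) = Ideal.Quotient.mk (jacobianIdeal f) (g l i))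
    (c : ((l : ℕ+) × Fin (Module.finrank L (jacobianA f d l))) →₀ L)
    (hc : ∑ x ∈ c.support, c x • frac f (g x.1 x.2) x.1 ∈ exactPart hf) : c = 0 := by
  classical
  by_contra hne
  obtain ⟨x₀, hx₀, hmax⟩ := Finset.exists_max_image c.support (fun x => x.1)
    (Finsupp.support_nonempty_iff.2 hne)
  obtain ⟨k, i₀⟩ := x₀
  have h1 : ∑ x ∈ c.support, c x • frac f (g x.1 x.2) x.1 =
      frac f (∑ x ∈ c.support, c x • (f ^ ((k : ℕ) - x.1) * g x.1 x.2)) k := by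
    rw [frac_sum]
    refine Finset.sum_congr rfl fun x hx => ?_
    have h2 := frac_pow_mul f (g x.1 x.2) ((k : ℕ) - x.1) x.1
    rw [Nat.sub_add_cancel (PNat.coe_le_coe _ _ |>.2 (hmax x hx))] at h2
    rw [← smul_frac, h2]
  rw [h1] at hc
  have h3 := mem_jacobianIdeal_of_frac_mem_exactPart hn hf hH hc
  have hfJ := self_mem_jacobianIdeal hf (degree_ne_zero_and_ne_zero hf hH).1
  have h4 : ∑ i, c ⟨k, i⟩ • (b k i : JacobianRing f) = 0 := by
    rw [← Ideal.Quotient.eq_zero_iff_mem, map_sum] at h3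
    have hmk (i) : c ⟨k, i⟩ • (b k i : JacobianRing f) = Ideal.Quotient.mk (jacobianIdeal f)
        (c ⟨k, i⟩ • (f ^ ((k : ℕ) - (k : ℕ)) * g k i)) := by
      rw [Nat.sub_self, pow_zero, one_mul, hb]
      rfl
    rw [← h3, Finset.sum_congr rfl fun i _ => hmk i]
    refine (Finset.sum_map Finset.univ (Function.Embedding.sigmaMk k) fun x =>
      Ideal.Quotient.mk (jacobianIdeal f) (c x • (f ^ ((k : ℕ) - x.1) * g x.1 x.2))).symm.trans ?_
    refine Finset.sum_congr_of_eq_on_inter (fun x _ hx => ?_) (fun x hx hxk => ?_)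
      fun _ _ _ => rfl
    · rw [Finsupp.notMem_support_iff.1 hx, zero_smul, map_zero]
    · have hlt : (x.1 : ℕ) < k := by
        refine PNat.coe_lt_coe _ _ |>.2 (lt_of_le_of_ne (hmax x hx) ?_)
        rintro rfl
        exact hxk (Finset.mem_map.2 ⟨x.2, Finset.mem_univ _, rfl⟩)
      rw [Ideal.Quotient.eq_zero_iff_mem]
      exact Submodule.smul_of_tower_mem _ _ (Ideal.mul_mem_right _ _
        (Ideal.pow_mem_of_mem _ hfJ _ (Nat.sub_pos_of_lt hlt)))
  have h5 : ∑ i, c ⟨k, i⟩ • b k i = 0 := by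
    apply Subtype.val_injective
    rw [← Submodule.subtype_apply, map_sum]
    exact h4
  exact Finsupp.mem_support_iff.1 hx₀ (Fintype.linearIndependent_iff.1 (b k).linearIndependent
    (fun i => c ⟨k, i⟩) h5 i₀)

end Basis

end GriffithsDwork

end

/-! ### Passage to the quotient. -/

theorem mainTheorem4 {L : Type*} [Field L] [CharZero L] {n d : ℕ} (hn : 1 ≤ n)
    (f : MvPolynomial (Fin (n + 1)) L) (hf : f.IsHomogeneous d)
    (hH : Module.Finite L (GriffithsDwork.JacobianRing f))
    (g : (l : ℕ+) → Fin (Module.finrank L (GriffithsDwork.jacobianA f d l)) →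
      MvPolynomial (Fin (n + 1)) L)
    (hg : ∀ (l : ℕ+) i, g l i ∈
      GriffithsDwork.homogPoly (Fin (n + 1)) L (((l : ℕ) : ℤ) * d - (n + 1)))
    (b : (l : ℕ+) → Module.Basis (Fin (Module.finrank L (GriffithsDwork.jacobianA f d l))) L
      (GriffithsDwork.jacobianA f d l))
    (hb : ∀ l i, (b l i : GriffithsDwork.JacobianRing f) =
      Ideal.Quotient.mk (GriffithsDwork.jacobianIdeal f) (g l i)) :
    ∃ B : Module.Basis
        ((l : ℕ+) × Fin (Module.finrank L (GriffithsDwork.jacobianA f d l))) L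
        (GriffithsDwork.Hpr hf),
      ∀ l i, B ⟨l, i⟩ = GriffithsDwork.Hpr.mk hf (GriffithsDwork.frac f (g l i) l)
        (GriffithsDwork.frac_mem_of_mem hf (hg l i)) := by
  let w : (l : ℕ+) × Fin (Module.finrank L (GriffithsDwork.jacobianA f d l)) →
      GriffithsDwork.homogFrac hf (-(n : ℤ) - 1) := fun x =>
    ⟨GriffithsDwork.frac f (g x.1 x.2) x.1, GriffithsDwork.frac_mem_of_mem hf (hg x.1 x.2)⟩
  let E := (GriffithsDwork.exactPart hf).submoduleOf
    (GriffithsDwork.homogFrac hf (-(n : ℤ) - 1))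
  have hlin (c) : Finsupp.linearCombination L (fun x => E.mkQ (w x)) c =
      E.mkQ (∑ x ∈ c.support, c x • w x) := by
    rw [Finsupp.linearCombination_apply, Finsupp.sum, map_sum]
    rfl
  have hval (c : ((l : ℕ+) × Fin (Module.finrank L (GriffithsDwork.jacobianA f d l))) →₀ L) :
      ((∑ x ∈ c.support, c x • w x : GriffithsDwork.homogFrac hf (-(n : ℤ) - 1)) :
        GriffithsDwork.FracRing f) =
        ∑ x ∈ c.support, c x • GriffithsDwork.frac f (g x.1 x.2) x.1 := by
    rw [← Submodule.subtype_apply, map_sum]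
    rfl
  have hli : LinearIndependent L fun x => E.mkQ (w x) := by
    rw [linearIndependent_iff]
    intro c hc
    rw [hlin, Submodule.mkQ_apply, Submodule.Quotient.mk_eq_zero] at hc
    refine GriffithsDwork.eq_zero_of_sum_mem_exactPart g b hn hf hH hb c ?_
    rw [← hval]
    exact hc
  have hsp : ⊤ ≤ Submodule.span L (Set.range fun x => E.mkQ (w x)) := by
    rintro q -
    obtain ⟨⟨F, hF⟩, rfl⟩ := E.mkQ_surjective q
    obtain ⟨_, hu, e, he, rfl⟩ := Submodule.mem_sup.1
      (GriffithsDwork.homogFrac_le_span_sup_exactPart g b hn hf hg hb hF)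
    obtain ⟨c, rfl⟩ := Finsupp.mem_span_range_iff_exists_finsupp.1 hu
    refine Finsupp.mem_span_range_iff_exists_finsupp.2 ⟨c, ?_⟩
    rw [← Finsupp.linearCombination_apply, hlin, Submodule.mkQ_apply, Submodule.mkQ_apply, eq_comm,
      Submodule.Quotient.eq]
    change (_ - _ : GriffithsDwork.FracRing f) ∈ GriffithsDwork.exactPart hf
    rw [hval]
    convert he using 1
    exact add_sub_cancel_left _ _
  exact ⟨Module.Basis.mk hli hsp, fun l i => Module.Basis.mk_apply hli hsp ⟨l, i⟩⟩
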